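/- Let $M$ be a smooth manifold and let $(A,[\cdot,\cdot],\rho)$ be a Lie algebroid over $M$ (a smooth real vector bundle of finite rank with a Lie bracket on its sections and an anchor $\rho:A\to TM$, a morphism of Lie algebras on sections, such that $[X,fY]=f[X,Y]+(\rho(X)f)\,Y$), with differential $\mathrm d$. Let $\phi_0\in\Omega^1(A)$ be a $1$-cocycle, $\mathrm d\phi_0=0$. For a $1$-form $\phi$ put $\mathrm d^{\phi}\omega=\mathrm d\omega+\phi\wedge\omega$ and $\mathcal L^{\phi}_X\alpha=i_X\mathrm d^{\phi}\alpha+\mathrm d^{\phi}i_X\alpha$ for a section $X$ and a $1$-form $\alpha$; for a bivector $P\in\mathfrak X^2(A)$ define $P^\sharp:A^*\to A$ by $\langle\beta,P^\sharp\alpha\rangle=P(\alpha,\beta)$, and set $$[\alpha,\beta]_P=\mathcal L^{\phi}_{P^\sharp\alpha}\beta-\mathcal L^{\phi}_{P^\sharp\beta}\alpha-\mathrm d^{\phi}(P(\alpha,\beta)),\qquad \alpha,\beta\in\Omega^1(A),$$ the bracket on $\Omega^1(A)$ determined by $(A,\phi)$ and $P$. Let $P\in\mathfrak X^2(A)$ be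 a Jacobi bivector on $(A,\phi_0)$, i.e. $[P,P]^{\phi_0}=[P,P]+2\,P^\sharp(\phi_0)\wedge P=0$, where $[\cdot,\cdot]$ is the Schouten bracket, with $[X_1\wedge X_2,Y_1\wedge Y_2]=\sum_{i,j}(-1)^{i+j}[X_i,Y_j]\wedge X_{3-i}\wedge Y_{3-j}$. Let $N:A\to A$ be a Nijenhuis operator (a bundle map over the identity with $[NX,NY]=N[X,Y]_N$ for all sections $X,Y$, where $[X,Y]_N=[NX,Y]+[X,NY]-N[X,Y]$), and let $A_N$ be the Lie algebroid $(A,[\cdot,\cdot]_N,\rho\circ N)$. Assume that $P$ and $N$ are compatible: $N\circ P^\sharp=P^\sharp\circ N^*$ (so that $NP$, with $(NP)^\sharp=N\circ P^\sharp$, is a bivector), and the bracket on $\Omega^1(A)$ determined by $(A,\phi_0)$ and $NP$ coincides with the one determined by $(A_N,N^*\phi_0)$ and $P$. In other words, $(A,\phi_0,P,N)$ is a Jacobi–Nijenhuis algebroid. For $k\in\mathbb N=\{0,1,2,\dots\}$ let $N^kP$ be the bivector on $A$ with $(N^kP)^\sharp=N^k\circ P^\sharp$, and let $\Lambda_k$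 and $E_k$ be the bivector field and the vector field on $M$ given by $$\Lambda_k(\alpha,\beta)=(N^kP)(\rho^*\alpha,\rho^*\beta)\quad(\alpha,\beta\in\Omega^1(M)),\qquad E_k=\rho\big((N^kP)^\sharp(\phi_0)\big).$$ Then every $(\Lambda_k,E_k)$ is a Jacobi structure on $M$, i.e. $[\Lambda_k,\Lambda_k]=-2\,E_k\wedge\Lambda_k$ and $[E_k,\Lambda_k]=0$, and these Jacobi structures are pairwise compatible: for all $i,j\in\mathbb N$, $(\Lambda_i+\Lambda_j,\,E_i+E_j)$ is again a Jacobi structure on $M$. -/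

import Mathlib

open Bundle Manifold VectorField
open scoped ContDiff

set_option linter.unusedSectionVars false

noncomputable section

/-! ### Smooth functions, sections and vector fields -/

section Sections

variable {E : Type*} [NormedAddCommGroup E] [NormedSpace ℝ E]
  {M : Type*} [TopologicalSpace M] [ChartedSpace E M]
  {F : Type*} [NormedAddCommGroup F] [NormedSpace ℝ F]
  {V : M → Type*} [TopologicalSpace (TotalSpace F V)]
  [∀ x, TopologicalSpace (V x)] [FiberBundle F V]
  [∀ x, AddCommGroup (V x)] [∀ x, Module ℝ (V x)] [VectorBundle ℝ F V]

/-- Multiplication of a smooth section by a smooth function. -/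
instance instSMulSmoothSection : SMul C^∞⟮𝓘(ℝ, E), M; ℝ⟯ Cₛ^∞⟮𝓘(ℝ, E); F, V⟯ :=
  ⟨fun f s => ⟨fun x => f x • s x, ContMDiff.smul_section f.contMDiff s.contMDiff⟩⟩

theorem smoothSection_smul_apply (f : C^∞⟮𝓘(ℝ, E), M; ℝ⟯) (s : Cₛ^∞⟮𝓘(ℝ, E); F, V⟯) (x : M) :
    (f • s) x = f x • s x := rfl

/-- Smooth sections form a module over the ring of smooth functions. -/
instance instModuleSmoothSection : Module C^∞⟮𝓘(ℝ, E), M; ℝ⟯ Cₛ^∞⟮𝓘(ℝ, E); F, V⟯ where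
  one_smul s := by ext x; simp [smoothSection_smul_apply]
  mul_smul f g s := by ext x; simp [smoothSection_smul_apply, mul_smul]
  smul_zero f := by ext x; simp [smoothSection_smul_apply]
  smul_add f s t := by ext x; simp [smoothSection_smul_apply]
  add_smul f g s := by ext x; simp [smoothSection_smul_apply, add_smul]
  zero_smul s := by ext x; simp [smoothSection_smul_apply]

end Sections

section VectorFields

variable {E : Type*} [NormedAddCommGroup E] [NormedSpace ℝ E]
  {M : Type*} [TopologicalSpace M] [ChartedSpace E M] [IsManifold 𝓘(ℝ, E) ∞ M]

variable (E M) in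
/-- Smooth vector fields on `M`. -/
abbrev VectorFields : Type _ :=
  Cₛ^∞⟮𝓘(ℝ, E); E, (TangentSpace 𝓘(ℝ, E) : M → Type _)⟯

/-- The derivative `X f` of a smooth function `f` along a smooth vector field `X`. -/
def vfApply (X : VectorFields E M) (f : C^∞⟮𝓘(ℝ, E), M; ℝ⟯) : C^∞⟮𝓘(ℝ, E), M; ℝ⟯ :=
  ⟨fun x => mvfderiv 𝓘(ℝ, E) f x (X x), by
    have h := (f.contMDiff.contMDiff_tangentMap (m := ∞) (by simp)).comp X.contMDiff
    exact (contMDiff_snd_tangentBundle_modelSpace ℝ 𝓘(ℝ, ℝ)).comp h⟩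

theorem vfApply_apply (X : VectorFields E M) (f : C^∞⟮𝓘(ℝ, E), M; ℝ⟯) (x : M) :
    vfApply X f x = mvfderiv 𝓘(ℝ, E) f x (X x) := rfl

theorem vfApply_add_right (X : VectorFields E M) (f g : C^∞⟮𝓘(ℝ, E), M; ℝ⟯) :
    vfApply X (f + g) = vfApply X f + vfApply X g := by
  ext x
  have hf := (f.contMDiff.mdifferentiable (by simp)) x
  have hg := (g.contMDiff.mdifferentiable (by simp)) x
  have h := congrArg (fun L => L (X x)) (mvfderiv_add hf hg)
  simpa [vfApply_apply] using h

theorem vfApply_neg_right (X : VectorFields E M) (f : C^∞⟮𝓘(ℝ, E), M; ℝ⟯) :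
    vfApply X (-f) = -vfApply X f := by
  ext x
  simp [vfApply_apply, mvfderiv_neg]

theorem vfApply_mul (X : VectorFields E M) (f g : C^∞⟮𝓘(ℝ, E), M; ℝ⟯) :
    vfApply X (f * g) = f * vfApply X g + g * vfApply X f := by
  ext x
  have hf := (f.contMDiff.mdifferentiable (by simp)) x
  have hg := (g.contMDiff.mdifferentiable (by simp)) x
  have h := congrArg (fun L => L (X x)) (mvfderiv_mul hf hg)
  simpa [vfApply_apply] using h

theorem vfApply_add_left (X Y : VectorFields E M) (f : C^∞⟮𝓘(ℝ, E), M; ℝ⟯) :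
    vfApply (X + Y) f = vfApply X f + vfApply Y f := by
  ext x; simp [vfApply_apply]

theorem vfApply_smul_left (g : C^∞⟮𝓘(ℝ, E), M; ℝ⟯) (X : VectorFields E M)
    (f : C^∞⟮𝓘(ℝ, E), M; ℝ⟯) : vfApply (g • X) f = g * vfApply X f := by
  ext x; simp [vfApply_apply, smoothSection_smul_apply]

theorem vfApply_neg_left (X : VectorFields E M) (f : C^∞⟮𝓘(ℝ, E), M; ℝ⟯) :
    vfApply (-X) f = -vfApply X f := by
  ext x; simp [vfApply_apply]

variable [FiniteDimensional ℝ E]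

/-- The Lie bracket of smooth vector fields. -/
def vfBracket (X Y : VectorFields E M) : VectorFields E M :=
  ⟨mlieBracket 𝓘(ℝ, E) X Y, by
    have := FiniteDimensional.complete ℝ E
    have : IsManifold 𝓘(ℝ, E) (minSmoothness ℝ 2) M := by
      rw [minSmoothness_of_isRCLikeNormedField]
      exact IsManifold.of_le (n := ∞) (WithTop.coe_le_coe.2 le_top)
    have : IsManifold 𝓘(ℝ, E) ((((⊤ : ℕ∞) : ℕ∞ω)) + 1) M :=
      inferInstanceAs (IsManifold 𝓘(ℝ, E) ∞ M)
    intro x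
    exact ContMDiffAt.mlieBracket_vectorField (m := ⊤) (n := ⊤) (X.contMDiff x) (Y.contMDiff x)
      (by rw [minSmoothness_of_isRCLikeNormedField]; simp)⟩

theorem vfBracket_apply (X Y : VectorFields E M) (x : M) :
    vfBracket X Y x = mlieBracket 𝓘(ℝ, E) X Y x := rfl

end VectorFields

/-! ### Lie algebroids -/

section LieAlgebroids

variable (E : Type*) [NormedAddCommGroup E] [NormedSpace ℝ E] [FiniteDimensional ℝ E]
  {M : Type*} [TopologicalSpace M] [ChartedSpace E M] [IsManifold 𝓘(ℝ, E) ∞ M]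
  (F : Type*) [NormedAddCommGroup F] [NormedSpace ℝ F]
  (V : M → Type*) [TopologicalSpace (TotalSpace F V)]
  [∀ x, TopologicalSpace (V x)] [FiberBundle F V]
  [∀ x, AddCommGroup (V x)] [∀ x, Module ℝ (V x)] [VectorBundle ℝ F V]

/-- A Lie algebroid structure on a vector bundle `V` over `M`: a Lie bracket on the smooth sections
and an anchor `V → TM` (given by its `C^∞(M)`-linear action on sections), which is a morphism of
Lie algebras, such that the Leibniz rule holds. (Real homogeneity of the bracket is the Leibniz
rule for constant functions.) -/
@[ext]
structure LieAlgebroid where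
  bracket : Cₛ^∞⟮𝓘(ℝ, E); F, V⟯ → Cₛ^∞⟮𝓘(ℝ, E); F, V⟯ → Cₛ^∞⟮𝓘(ℝ, E); F, V⟯
  anchor : Cₛ^∞⟮𝓘(ℝ, E); F, V⟯ →ₗ[C^∞⟮𝓘(ℝ, E), M; ℝ⟯] VectorFields E M
  bracket_add : ∀ X Y Z, bracket X (Y + Z) = bracket X Y + bracket X Z
  bracket_skew : ∀ X Y, bracket X Y = -bracket Y X
  bracket_jacobi : ∀ X Y Z,
    bracket X (bracket Y Z) = bracket (bracket X Y) Z + bracket Y (bracket X Z)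
  bracket_smul : ∀ X (f : C^∞⟮𝓘(ℝ, E), M; ℝ⟯) Y,
    bracket X (f • Y) = f • bracket X Y + vfApply (anchor X) f • Y
  anchor_bracket : ∀ X Y, anchor (bracket X Y) = vfBracket (anchor X) (anchor Y)

/-- 1-forms on `V`, i.e. sections of the dual bundle. -/
abbrev OneForm : Type _ := Module.Dual C^∞⟮𝓘(ℝ, E), M; ℝ⟯ Cₛ^∞⟮𝓘(ℝ, E); F, V⟯

/-- Bundle maps `V → V` over the identity, given by their action on sections. -/
abbrev BundleEnd : Type _ := Module.End C^∞⟮𝓘(ℝ, E), M; ℝ⟯ Cₛ^∞⟮𝓘(ℝ, E); F, V⟯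

/-- A bivector field `P` on `V` (a section of `Λ² V`), given by the skew-symmetric bundle map
`P♯ : V* → V`, where `⟨β, P♯ α⟩ = P(α, β)`. -/
@[ext]
structure Bivector where
  sharp : OneForm E F V →ₗ[C^∞⟮𝓘(ℝ, E), M; ℝ⟯] Cₛ^∞⟮𝓘(ℝ, E); F, V⟯
  alternating : ∀ α : OneForm E F V, α (sharp α) = 0

end LieAlgebroids

section Calculus

variable {E : Type*} [NormedAddCommGroup E] [NormedSpace ℝ E] [FiniteDimensional ℝ E]
  {M : Type*} [TopologicalSpace M] [ChartedSpace E M] [IsManifold 𝓘(ℝ, E) ∞ M]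
  {F : Type*} [NormedAddCommGroup F] [NormedSpace ℝ F]
  {V : M → Type*} [TopologicalSpace (TotalSpace F V)]
  [∀ x, TopologicalSpace (V x)] [FiberBundle F V]
  [∀ x, AddCommGroup (V x)] [∀ x, Module ℝ (V x)] [VectorBundle ℝ F V]

namespace Bivector

/-- The value `P(α, β) = ⟨β, P♯ α⟩`. -/
def eval (P : Bivector E F V) (α β : OneForm E F V) : C^∞⟮𝓘(ℝ, E), M; ℝ⟯ := β (P.sharp α)

theorem eval_skew (P : Bivector E F V) (α β : OneForm E F V) : P.eval α β = -P.eval β α := by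
  have h := P.alternating (α + β)
  simp only [map_add, LinearMap.add_apply, P.alternating, zero_add, add_zero] at h
  rw [eq_neg_iff_add_eq_zero, add_comm]
  exact (add_comm _ _).trans h

instance : Add (Bivector E F V) :=
  ⟨fun P Q => ⟨P.sharp + Q.sharp, fun α => by simp [P.alternating, Q.alternating]⟩⟩

/-- The bivector `X ∧ Y`, with `(X ∧ Y)(α, β) = α(X) β(Y) - α(Y) β(X)`. -/
def wedge (X Y : Cₛ^∞⟮𝓘(ℝ, E); F, V⟯) : Bivector E F V where
  sharp :=
    { toFun := fun α => α X • Y - α Y • X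
      map_add' := fun α β => by simp only [LinearMap.add_apply, add_smul]; abel
      map_smul' := fun f α => by
        simp only [LinearMap.smul_apply, smul_eq_mul, mul_smul, RingHom.id_apply, smul_sub] }
  alternating := fun α => by
    simp only [LinearMap.coe_mk, AddHom.coe_mk, map_sub, map_smul, smul_eq_mul]; ring

theorem iterate_skew (P : Bivector E F V) (N : BundleEnd E F V)
    (h : ∀ α, N (P.sharp α) = P.sharp (N.dualMap α)) (k : ℕ) (α β : OneForm E F V) :
    β ((N ^ k) (P.sharp α)) = -α ((N ^ k) (P.sharp β)) := by
  induction k generalizing α β with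
  | zero => simpa [eval] using P.eval_skew α β
  | succ k ih =>
    have h1 : β ((N ^ (k + 1)) (P.sharp α)) = β ((N ^ k) (P.sharp (N.dualMap α))) := by
      rw [pow_succ, Module.End.mul_apply, h]
    rw [h1, ih, pow_succ', Module.End.mul_apply]
    rfl

/-- The bivector `Nᵏ P`, with `(Nᵏ P)♯ = Nᵏ ∘ P♯`, when `N P = P N*`. -/
def iterate (P : Bivector E F V) (N : BundleEnd E F V)
    (h : ∀ α, N (P.sharp α) = P.sharp (N.dualMap α)) (k : ℕ) : Bivector E F V where
  sharp := (N ^ k) ∘ₗ P.sharp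
  alternating := fun α => by
    have h2 := P.iterate_skew N h k α α
    ext x
    have h3 := congrArg (fun f : C^∞⟮𝓘(ℝ, E), M; ℝ⟯ => f x) h2
    simp only [ContMDiffMap.coe_neg, Pi.neg_apply] at h3
    have : (α ((N ^ k) (P.sharp α)) : M → ℝ) x = 0 := by linarith
    simpa using this

end Bivector

namespace LieAlgebroid

variable (A : LieAlgebroid E F V)

theorem bracket_add_left (X Y Z : Cₛ^∞⟮𝓘(ℝ, E); F, V⟯) :
    A.bracket (X + Y) Z = A.bracket X Z + A.bracket Y Z := by
  rw [A.bracket_skew, A.bracket_add, A.bracket_skew X, A.bracket_skew Y]; abel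

theorem bracket_smul_left (f : C^∞⟮𝓘(ℝ, E), M; ℝ⟯) (X Y : Cₛ^∞⟮𝓘(ℝ, E); F, V⟯) :
    A.bracket (f • X) Y = f • A.bracket X Y - vfApply (A.anchor Y) f • X := by
  rw [A.bracket_skew, A.bracket_smul, A.bracket_skew X, smul_neg]; abel

/-- The algebroid differential of a function: `(d f)(X) = ρ(X) f`. -/
def dFun (f : C^∞⟮𝓘(ℝ, E), M; ℝ⟯) : OneForm E F V where
  toFun X := vfApply (A.anchor X) f
  map_add' X Y := by rw [map_add, vfApply_add_left]
  map_smul' g X := by rw [map_smul, vfApply_smul_left]; rfl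

/-- The algebroid differential of a 1-form:
`(d α)(X, Y) = ρ(X) α(Y) - ρ(Y) α(X) - α([X, Y])`. -/
def dForm (α : OneForm E F V) :
    Cₛ^∞⟮𝓘(ℝ, E); F, V⟯ →ₗ[C^∞⟮𝓘(ℝ, E), M; ℝ⟯] OneForm E F V :=
  LinearMap.mk₂ _ (fun X Y => A.dFun (α Y) X - A.dFun (α X) Y - α (A.bracket X Y))
    (fun X X' Y => by
      simp only [dFun, LinearMap.coe_mk, AddHom.coe_mk, map_add,
        vfApply_add_right, A.bracket_add_left]
      ring)
    (fun f X Y => by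
      simp only [dFun, LinearMap.coe_mk, AddHom.coe_mk, map_smul, smul_eq_mul,
        vfApply_mul, A.bracket_smul_left, map_sub]
      ring)
    (fun X Y Y' => by
      simp only [dFun, LinearMap.coe_mk, AddHom.coe_mk, map_add,
        vfApply_add_right, A.bracket_add]
      ring)
    (fun f X Y => by
      simp only [dFun, LinearMap.coe_mk, AddHom.coe_mk, map_smul, smul_eq_mul,
        vfApply_mul, A.bracket_smul, map_add]
      ring)

/-- The wedge product of 1-forms: `(φ ∧ β)(X, Y) = φ(X) β(Y) - φ(Y) β(X)`. -/
def wedgeForm (φ β : OneForm E F V) :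
    Cₛ^∞⟮𝓘(ℝ, E); F, V⟯ →ₗ[C^∞⟮𝓘(ℝ, E), M; ℝ⟯] OneForm E F V :=
  φ.smulRight β - β.smulRight φ

/-- The `φ`-differential `d f + f φ` of a function. -/
def dFunTwisted (φ : OneForm E F V) (f : C^∞⟮𝓘(ℝ, E), M; ℝ⟯) : OneForm E F V :=
  A.dFun f + f • φ

/-- The `φ`-differential `d α + φ ∧ α` of a 1-form. -/
def dFormTwisted (φ α : OneForm E F V) :
    Cₛ^∞⟮𝓘(ℝ, E); F, V⟯ →ₗ[C^∞⟮𝓘(ℝ, E), M; ℝ⟯] OneForm E F V :=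
  A.dForm α + wedgeForm φ α

/-- The Lie derivative `L_X α = i_X d α + d i_X α` of a 1-form. -/
def lieDeriv (X : Cₛ^∞⟮𝓘(ℝ, E); F, V⟯) (α : OneForm E F V) : OneForm E F V :=
  A.dForm α X + A.dFun (α X)

/-- The `φ`-Lie derivative `i_X d^φ α + d^φ i_X α` of a 1-form. -/
def lieDerivTwisted (φ : OneForm E F V) (X : Cₛ^∞⟮𝓘(ℝ, E); F, V⟯) (α : OneForm E F V) :
    OneForm E F V :=
  A.dFormTwisted φ α X + A.dFunTwisted φ (α X)

/-- The bracket `[α, β]_P = L^φ_{P♯α} β - L^φ_{P♯β} α - d^φ P(α, β)` of 1-forms determined by the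
1-cocycle `φ` and the bivector `P`. -/
def dualBracket (φ : OneForm E F V) (P : Bivector E F V) (α β : OneForm E F V) : OneForm E F V :=
  A.lieDerivTwisted φ (P.sharp α) β - A.lieDerivTwisted φ (P.sharp β) α
    - A.dFunTwisted φ (P.eval α β)

/-! Multivectors of degree 3 are regarded as functions of three 1-forms. -/

/-- The trivector `X ∧ Q`, for a section `X` and a bivector `Q`. -/
def wedgeBivector (X : Cₛ^∞⟮𝓘(ℝ, E); F, V⟯) (Q : Bivector E F V) (α β γ : OneForm E F V) :
    C^∞⟮𝓘(ℝ, E), M; ℝ⟯ :=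
  α X * Q.eval β γ + β X * Q.eval γ α + γ X * Q.eval α β

/-- The Schouten bracket `[X, Q]` of a section and a bivector (the Lie derivative of `Q`),
as a function of two 1-forms. -/
def schoutenSection (X : Cₛ^∞⟮𝓘(ℝ, E); F, V⟯) (Q : Bivector E F V) (α β : OneForm E F V) :
    C^∞⟮𝓘(ℝ, E), M; ℝ⟯ :=
  vfApply (A.anchor X) (Q.eval α β) - Q.eval (A.lieDeriv X α) β - Q.eval α (A.lieDeriv X β)

/-- One of the three cyclic summands of the Schouten bracket of two bivectors. -/
def schoutenTerm (P Q : Bivector E F V) (α β γ : OneForm E F V) : C^∞⟮𝓘(ℝ, E), M; ℝ⟯ :=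
  vfApply (A.anchor (P.sharp α)) (Q.eval β γ) + vfApply (A.anchor (Q.sharp α)) (P.eval β γ)
    - A.dForm α (P.sharp β) (Q.sharp γ) - A.dForm α (Q.sharp β) (P.sharp γ)

/-- The Schouten bracket `[P, Q]` of two bivectors, as a function of three 1-forms. By
`schouten_wedge_wedge` it is the biadditive extension of
`[X ∧ Y, Z ∧ W] = [X, Z] ∧ Y ∧ W - [X, W] ∧ Y ∧ Z - [Y, Z] ∧ X ∧ W + [Y, W] ∧ X ∧ Z`. -/
def schouten (P Q : Bivector E F V) (α β γ : OneForm E F V) : C^∞⟮𝓘(ℝ, E), M; ℝ⟯ :=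
  A.schoutenTerm P Q α β γ + A.schoutenTerm P Q β γ α + A.schoutenTerm P Q γ α β

theorem schouten_wedge_wedge (X Y Z W : Cₛ^∞⟮𝓘(ℝ, E); F, V⟯) (α β γ : OneForm E F V) :
    A.schouten (.wedge X Y) (.wedge Z W) α β γ =
      wedgeBivector (A.bracket X Z) (.wedge Y W) α β γ
      - wedgeBivector (A.bracket X W) (.wedge Y Z) α β γ
      - wedgeBivector (A.bracket Y Z) (.wedge X W) α β γ
      + wedgeBivector (A.bracket Y W) (.wedge X Z) α β γ := by
  simp only [schouten, schoutenTerm, wedgeBivector, Bivector.eval, Bivector.wedge, dForm, dFun,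
    LinearMap.mk₂_apply, LinearMap.coe_mk, AddHom.coe_mk, map_smul, smul_eq_mul, sub_eq_add_neg,
    vfApply_add_right, vfApply_neg_right, vfApply_mul, map_add, map_neg, vfApply_add_left,
    vfApply_neg_left, vfApply_smul_left, A.bracket_skew Z X, A.bracket_skew Z Y,
    A.bracket_skew W X, A.bracket_skew W Y, LinearMap.add_apply, LinearMap.neg_apply,
    LinearMap.smul_apply]
  ring

/-- The Schouten–Jacobi bracket of two bivectors:
`[P, Q]^φ = [P, Q] + P ∧ i_φ Q + i_φ P ∧ Q`, where `i_φ P = P♯ φ`. -/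
def schoutenJacobi (φ : OneForm E F V) (P Q : Bivector E F V) (α β γ : OneForm E F V) :
    C^∞⟮𝓘(ℝ, E), M; ℝ⟯ :=
  A.schouten P Q α β γ + wedgeBivector (Q.sharp φ) P α β γ + wedgeBivector (P.sharp φ) Q α β γ

/-- `φ` is a 1-cocycle, so that `(A, φ)` is a Jacobi algebroid. -/
def IsCocycle (φ : OneForm E F V) : Prop := A.dForm φ = 0

/-- `P` is a Jacobi bivector on `(A, φ)`. -/
def IsJacobiBivector (φ : OneForm E F V) (P : Bivector E F V) : Prop :=
  A.schoutenJacobi φ P P = 0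

/-- The bracket `[X, Y]_N = [N X, Y] + [X, N Y] - N [X, Y]`. -/
def deformedBracket (N : BundleEnd E F V) (X Y : Cₛ^∞⟮𝓘(ℝ, E); F, V⟯) : Cₛ^∞⟮𝓘(ℝ, E); F, V⟯ :=
  A.bracket (N X) Y + A.bracket X (N Y) - N (A.bracket X Y)

/-- `N` is a Nijenhuis operator: its torsion vanishes. -/
def IsNijenhuis (N : BundleEnd E F V) : Prop :=
  ∀ X Y, A.bracket (N X) (N Y) - N (A.deformedBracket N X Y) = 0

theorem bracket_sub (X Y Z : Cₛ^∞⟮𝓘(ℝ, E); F, V⟯) :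
    A.bracket X (Y - Z) = A.bracket X Y - A.bracket X Z := by
  rw [eq_sub_iff_add_eq, ← A.bracket_add, sub_add_cancel]

theorem bracket_sub_left (X Y Z : Cₛ^∞⟮𝓘(ℝ, E); F, V⟯) :
    A.bracket (X - Y) Z = A.bracket X Z - A.bracket Y Z := by
  rw [eq_sub_iff_add_eq, ← A.bracket_add_left, sub_add_cancel]

/-- The deformed Lie algebroid `A_N`, with bracket `[·, ·]_N` and anchor `ρ ∘ N`. -/
def deform (N : BundleEnd E F V) (hN : A.IsNijenhuis N) : LieAlgebroid E F V where
  bracket := A.deformedBracket N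
  anchor := A.anchor ∘ₗ N
  bracket_add X Y Z := by
    simp only [deformedBracket, map_add, A.bracket_add]; abel
  bracket_skew X Y := by
    rw [deformedBracket, deformedBracket, A.bracket_skew (N X), A.bracket_skew X (N Y),
      A.bracket_skew X Y, map_neg]; abel
  bracket_jacobi X Y Z := by
    have hT : ∀ X Y, N (A.deformedBracket N X Y) = A.bracket (N X) (N Y) :=
      fun X Y => (sub_eq_zero.mp (hN X Y)).symm
    have key : ∀ X Y Z, A.deformedBracket N X (A.deformedBracket N Y Z) =
        A.bracket (N X) (A.bracket (N Y) Z) + A.bracket (N X) (A.bracket Y (N Z))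
        + A.bracket X (A.bracket (N Y) (N Z)) - N (A.bracket (N X) (A.bracket Y Z))
        - N (A.bracket X (A.bracket (N Y) Z)) - N (A.bracket X (A.bracket Y (N Z)))
        + N (N (A.bracket X (A.bracket Y Z))) := by
      intro X Y Z
      have h1 : A.deformedBracket N X (A.deformedBracket N Y Z) =
          A.bracket (N X) (A.deformedBracket N Y Z) + A.bracket X (A.bracket (N Y) (N Z))
          - N (A.bracket X (A.deformedBracket N Y Z)) := by
        rw [← hT Y Z]; rfl
      have h2 : A.bracket (N X) (N (A.bracket Y Z)) = N (A.bracket (N X) (A.bracket Y Z))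
          + N (A.bracket X (N (A.bracket Y Z))) - N (N (A.bracket X (A.bracket Y Z))) := by
        rw [← hT, deformedBracket, map_sub, map_add]
      rw [h1, deformedBracket, A.bracket_sub, A.bracket_sub, A.bracket_add, A.bracket_add, h2,
        map_sub, map_add]
      abel
    have J : ∀ X Y Z, A.bracket X (A.bracket Y Z) =
        -A.bracket Z (A.bracket X Y) + A.bracket Y (A.bracket X Z) := by
      intro X Y Z
      rw [A.bracket_jacobi, A.bracket_skew (A.bracket X Y)]
    have hskew : ∀ X Y, A.deformedBracket N X Y = -A.deformedBracket N Y X := by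
      intro X Y
      rw [deformedBracket, deformedBracket, A.bracket_skew (N X), A.bracket_skew X (N Y),
        A.bracket_skew X Y, map_neg]
      abel
    rw [hskew (A.deformedBracket N X Y) Z, key, key, key, J (N X) (N Y) Z, J (N X) Y (N Z),
      J X (N Y) (N Z), J (N X) Y Z, J X (N Y) Z, J X Y (N Z), J X Y Z]
    simp only [map_add, map_neg]
    abel
  bracket_smul X f Y := by
    simp only [deformedBracket, map_smul, A.bracket_smul, map_add, LinearMap.comp_apply,
      smul_add, smul_sub]; abel
  anchor_bracket X Y := by
    rw [LinearMap.comp_apply, ← sub_eq_zero.mp (hN X Y), A.anchor_bracket]; rfl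

/-- `(A, φ₀, P, N)` is a Jacobi–Nijenhuis algebroid: `φ₀` is a 1-cocycle of the Lie algebroid `A`,
`P` is a Jacobi bivector on `(A, φ₀)`, `N` is a Nijenhuis operator on `A`, `N P = P N*`, and the
bracket on 1-forms determined by `(A, φ₀)` and the bivector `N P` coincides with the one determined
by `(A_N, N* φ₀)` and `P`. -/
structure IsJacobiNijenhuis (φ₀ : OneForm E F V) (P : Bivector E F V) (N : BundleEnd E F V) :
    Prop where
  cocycle : A.IsCocycle φ₀
  jacobi : A.IsJacobiBivector φ₀ P
  nijenhuis : A.IsNijenhuis N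
  comm : ∀ α, N (P.sharp α) = P.sharp (N.dualMap α)
  bracket_eq : ∀ α β, A.dualBracket φ₀ (P.iterate N comm 1) α β =
    (A.deform N nijenhuis).dualBracket (N.dualMap φ₀) P α β

end LieAlgebroid

end Calculus

/-! ### Jacobi structures on manifolds -/

section JacobiManifolds

variable {E : Type*} [NormedAddCommGroup E] [NormedSpace ℝ E] [FiniteDimensional ℝ E]
  {M : Type*} [TopologicalSpace M] [ChartedSpace E M] [IsManifold 𝓘(ℝ, E) ∞ M]

variable (E M) in
/-- The tangent bundle of `M` as a Lie algebroid, with the Lie bracket of vector fields and the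
identity as anchor. -/
def tangentAlgebroid : LieAlgebroid E E (TangentSpace 𝓘(ℝ, E) : M → Type _) where
  bracket := vfBracket
  anchor := LinearMap.id
  bracket_add X Y Z := by
    ext x
    exact mlieBracket_add_right (Y.mdifferentiableAt) (Z.mdifferentiableAt)
  bracket_skew X Y := by
    ext x
    exact mlieBracket_swap_apply
  bracket_jacobi X Y Z := by
    have := FiniteDimensional.complete ℝ E
    have : IsManifold 𝓘(ℝ, E) (minSmoothness ℝ 3) M := by
      rw [minSmoothness_of_isRCLikeNormedField]
      exact IsManifold.of_le (n := ∞) (WithTop.coe_le_coe.2 le_top)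
    ext x
    refine leibniz_identity_mlieBracket_apply ?_ ?_ ?_ <;>
      rw [minSmoothness_of_isRCLikeNormedField]
    · exact (X.contMDiff x).of_le (WithTop.coe_le_coe.2 le_top)
    · exact (Y.contMDiff x).of_le (WithTop.coe_le_coe.2 le_top)
    · exact (Z.contMDiff x).of_le (WithTop.coe_le_coe.2 le_top)
  bracket_smul X f Y := by
    have := FiniteDimensional.complete ℝ E
    ext x
    have hf := (f.contMDiff.mdifferentiable (by simp)) x
    have h := mlieBracket_smul_right (V := X) (W := Y) hf Y.mdifferentiableAt
    rw [add_comm] at h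
    exact h
  anchor_bracket _ _ := rfl

/-- A bivector field `Λ` on `M`. -/
abbrev BivectorField (E M : Type*) [NormedAddCommGroup E] [NormedSpace ℝ E]
    [TopologicalSpace M] [ChartedSpace E M] [IsManifold 𝓘(ℝ, E) ∞ M] : Type _ :=
  Bivector E E (TangentSpace 𝓘(ℝ, E) : M → Type _)

/-- `(Λ, Y)` is a Jacobi structure on `M`: `[Λ, Λ] = -2 Y ∧ Λ` and `[Y, Λ] = 0`. -/
def IsJacobiStructure (Λ : BivectorField E M) (Y : VectorFields E M) : Prop :=
  (tangentAlgebroid E M).schouten Λ Λ = (-2 : ℝ) • LieAlgebroid.wedgeBivector Y Λ ∧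
    (tangentAlgebroid E M).schoutenSection Y Λ = 0

/-- Two Jacobi structures on `M` are compatible if their sum is a Jacobi structure. -/
def AreCompatibleJacobi (Λ₁ : BivectorField E M) (Y₁ : VectorFields E M)
    (Λ₂ : BivectorField E M) (Y₂ : VectorFields E M) : Prop :=
  IsJacobiStructure Λ₁ Y₁ ∧ IsJacobiStructure Λ₂ Y₂ ∧ IsJacobiStructure (Λ₁ + Λ₂) (Y₁ + Y₂)

variable {F : Type*} [NormedAddCommGroup F] [NormedSpace ℝ F]
  {V : M → Type*} [TopologicalSpace (TotalSpace F V)]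
  [∀ x, TopologicalSpace (V x)] [FiberBundle F V]
  [∀ x, AddCommGroup (V x)] [∀ x, Module ℝ (V x)] [VectorBundle ℝ F V]

/-- The bivector field `P_M` on `M` with `P_M(α, β) = P(ρ* α, ρ* β)`. -/
def LieAlgebroid.baseBivector (A : LieAlgebroid E F V) (P : Bivector E F V) :
    BivectorField E M where
  sharp := A.anchor ∘ₗ P.sharp ∘ₗ A.anchor.dualMap
  alternating α := P.alternating (A.anchor.dualMap α)

/-- The vector field `E_M = ρ(P♯ φ)` on `M`. -/
def LieAlgebroid.baseVectorField (A : LieAlgebroid E F V) (φ : OneForm E F V)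
    (P : Bivector E F V) : VectorFields E M :=
  A.anchor (P.sharp φ)

end JacobiManifolds

end

/-!
Write `B_Q` for the bracket of 1-forms determined by `(A, φ₀)` and a bivector `Q`. Up to sign, the
Schouten–Jacobi bracket is
`[P, Q]^φ₀(α, β, γ) = ⟨γ, P♯ B_Q(α, β) + Q♯ B_P(α, β) - [P♯α, Q♯β] - [Q♯α, P♯β]⟩`
(`schoutenJacobi_eq`), so `P` is Jacobi exactly when `P♯` carries `B_P` to the bracket of `A`. All
identities of sections below are used only after pairing with a 1-form.

For a bundle map `K` with `K P♯ = P♯ K*`, the deviation of `B_{KP}` from the deformation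
`B_P(K*α, β) + B_P(α, K*β) - K* B_P(α, β)` is a tensor, the concomitant `C(P, K)`
(`dualBracket_apply_eq_add_concomitant`). It is also the difference of the two brackets
in the compatibility condition (`dualBracket_deform_sub`), so that condition says `C(P, N) = 0`.
If `P` is Jacobi and `C(P, K) = 0`, then applying `P♯` to the deformed bracket gives
`[P, KP]^φ₀ = 0`; if moreover `K` is Nijenhuis, then `KP` is itself Jacobi.

The Nijenhuis condition reads `N ∘ L_X N = L_{NX} N`. It yields
`C(N^k P, N)(α, β) = C(P, N)((N*)^k α, β)` (`concomitant_comp_pow`) and a recursion for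
`C(P, N^m)` (`concomitant_pow_succ`), so `C(N^k P, N^m) = 0` for all `k` and `m`. Hence every
`N^k P` is Jacobi and `[N^i P, N^j P]^φ₀ = 0`, so `N^i P + N^j P` is Jacobi as well.

Finally, a Jacobi bivector `Q` on `(A, φ₀)` induces a Jacobi structure on the base
(`IsJacobiBivector.isJacobiStructure_base`): the anchor is a morphism, so Schouten brackets are
natural under it, which gives `[Λ, Λ] = -2 E ∧ Λ`; contracting `[Q, Q]^φ₀ = 0` with the cocycle `φ₀`
gives `[Q♯φ₀, Q] = 0`, hence `[E, Λ] = 0`.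
-/

noncomputable section

section JacobiNijenhuis

variable {E : Type*} [NormedAddCommGroup E] [NormedSpace ℝ E] [FiniteDimensional ℝ E]
  {M : Type*} [TopologicalSpace M] [ChartedSpace E M] [IsManifold 𝓘(ℝ, E) ∞ M]
  {F : Type*} [NormedAddCommGroup F] [NormedSpace ℝ F]
  {V : M → Type*} [TopologicalSpace (TotalSpace F V)]
  [∀ x, TopologicalSpace (V x)] [FiberBundle F V]
  [∀ x, AddCommGroup (V x)] [∀ x, Module ℝ (V x)] [VectorBundle ℝ F V]

/-! ### Preliminaries on functions and bivectors -/

theorem smoothFunction_eq_zero_of_two_mul {f : C^∞⟮𝓘(ℝ, E), M; ℝ⟯} (h : 2 * f = 0) : f = 0 := by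
  ext x
  have h' := congrArg (fun g : C^∞⟮𝓘(ℝ, E), M; ℝ⟯ => g x) h
  rw [two_mul] at h'
  simp only [ContMDiffMap.coe_add, Pi.add_apply, ContMDiffMap.coe_zero, Pi.zero_apply] at h' ⊢
  linarith

namespace Bivector

theorem add_sharp (P Q : Bivector E F V) : (P + Q).sharp = P.sharp + Q.sharp := rfl

theorem apply_sharp_skew (P : Bivector E F V) (α β : OneForm E F V) :
    β (P.sharp α) = -α (P.sharp β) := P.eval_skew α β

theorem pow_sharp_comm {P : Bivector E F V} {N : BundleEnd E F V}
    (hNP : ∀ α, N (P.sharp α) = P.sharp (N.dualMap α)) (k : ℕ) (α : OneForm E F V) :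
    (N ^ k) (P.sharp α) = P.sharp ((N ^ k).dualMap α) := by
  induction k generalizing α with
  | zero => rfl
  | succ k ih =>
    have hdual : (N ^ (k + 1)).dualMap α = N.dualMap ((N ^ k).dualMap α) := by
      rw [pow_succ]
      rfl
    rw [hdual, ← hNP, ← ih, pow_succ', Module.End.mul_apply]

end Bivector

/-! ### The bracket of 1-forms and the Schouten–Jacobi bracket -/

namespace LieAlgebroid

variable (A : LieAlgebroid E F V)

theorem dFun_apply (f : C^∞⟮𝓘(ℝ, E), M; ℝ⟯) (X : Cₛ^∞⟮𝓘(ℝ, E); F, V⟯) :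
    A.dFun f X = vfApply (A.anchor X) f := rfl

theorem dForm_apply (α : OneForm E F V) (X Y : Cₛ^∞⟮𝓘(ℝ, E); F, V⟯) :
    A.dForm α X Y = vfApply (A.anchor X) (α Y) - vfApply (A.anchor Y) (α X)
      - α (A.bracket X Y) := rfl

theorem lieDeriv_apply (X Y : Cₛ^∞⟮𝓘(ℝ, E); F, V⟯) (α : OneForm E F V) :
    A.lieDeriv X α Y = vfApply (A.anchor X) (α Y) - α (A.bracket X Y) := by
  simp only [lieDeriv, LinearMap.add_apply, dForm_apply, dFun_apply]
  ring

theorem dualBracket_apply (φ : OneForm E F V) (Q : Bivector E F V) (α β : OneForm E F V)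
    (Y : Cₛ^∞⟮𝓘(ℝ, E); F, V⟯) :
    A.dualBracket φ Q α β Y =
      vfApply (A.anchor (Q.sharp α)) (β Y) - β (A.bracket (Q.sharp α) Y)
      - vfApply (A.anchor (Q.sharp β)) (α Y) + α (A.bracket (Q.sharp β) Y)
      - vfApply (A.anchor Y) (β (Q.sharp α))
      + φ (Q.sharp α) * β Y - φ (Q.sharp β) * α Y - β (Q.sharp α) * φ Y := by
  simp only [dualBracket, lieDerivTwisted, dFormTwisted, dFunTwisted, wedgeForm, Bivector.eval,
    LinearMap.add_apply, LinearMap.sub_apply, LinearMap.smul_apply, LinearMap.smulRight_apply,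
    smul_eq_mul, dForm_apply, dFun_apply]
  ring

/-- Up to sign, the Schouten–Jacobi bracket `[P, Q]^φ` is the polarized failure of `P♯` and `Q♯` to
intertwine the brackets of 1-forms with the bracket of `A`. -/
theorem schoutenJacobi_eq (φ : OneForm E F V) (P Q : Bivector E F V) (α β γ : OneForm E F V) :
    A.schoutenJacobi φ P Q α β γ =
      γ (A.bracket (P.sharp α) (Q.sharp β)) + γ (A.bracket (Q.sharp α) (P.sharp β))
      - γ (P.sharp (A.dualBracket φ Q α β)) - γ (Q.sharp (A.dualBracket φ P α β)) := by
  rw [P.apply_sharp_skew (A.dualBracket φ Q α β) γ, Q.apply_sharp_skew (A.dualBracket φ P α β) γ]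
  simp only [dualBracket_apply, schoutenJacobi, schouten, schoutenTerm, wedgeBivector,
    Bivector.eval, dForm_apply]
  rw [A.bracket_skew (P.sharp γ) (Q.sharp α), A.bracket_skew (Q.sharp γ) (P.sharp α),
    P.apply_sharp_skew φ α, P.apply_sharp_skew φ β, P.apply_sharp_skew φ γ,
    Q.apply_sharp_skew φ α, Q.apply_sharp_skew φ β, Q.apply_sharp_skew φ γ,
    P.apply_sharp_skew β α, P.apply_sharp_skew γ β, P.apply_sharp_skew γ α,
    Q.apply_sharp_skew β α, Q.apply_sharp_skew γ β, Q.apply_sharp_skew γ α]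
  simp only [vfApply_neg_right, map_neg]
  ring

theorem schoutenJacobi_comm (φ : OneForm E F V) (P Q : Bivector E F V) (α β γ : OneForm E F V) :
    A.schoutenJacobi φ P Q α β γ = A.schoutenJacobi φ Q P α β γ := by
  rw [schoutenJacobi_eq, schoutenJacobi_eq]
  ring

theorem schoutenJacobi_add_add (φ : OneForm E F V) (P Q : Bivector E F V) (α β γ : OneForm E F V) :
    A.schoutenJacobi φ (P + Q) (P + Q) α β γ = A.schoutenJacobi φ P P α β γ
      + 2 * A.schoutenJacobi φ P Q α β γ + A.schoutenJacobi φ Q Q α β γ := by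
  simp only [schoutenJacobi, schouten, schoutenTerm, wedgeBivector, Bivector.eval,
    Bivector.add_sharp, LinearMap.add_apply, map_add, vfApply_add_left, vfApply_add_right]
  ring

/-- `P` is a Jacobi bivector iff `P♯` maps the bracket of 1-forms to the bracket of `A`. Equality of
sections is expressed by pairing with 1-forms. -/
theorem isJacobiBivector_iff (φ : OneForm E F V) (P : Bivector E F V) :
    A.IsJacobiBivector φ P ↔ ∀ α β γ : OneForm E F V,
      γ (P.sharp (A.dualBracket φ P α β)) = γ (A.bracket (P.sharp α) (P.sharp β)) := by
  have key : ∀ α β γ : OneForm E F V, A.schoutenJacobi φ P P α β γ =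
      2 * (γ (A.bracket (P.sharp α) (P.sharp β)) - γ (P.sharp (A.dualBracket φ P α β))) := by
    intro α β γ
    rw [schoutenJacobi_eq]
    ring
  constructor
  · intro h α β γ
    have h' : A.schoutenJacobi φ P P α β γ = 0 := congrFun (congrFun (congrFun h α) β) γ
    rw [key] at h'
    exact (sub_eq_zero.mp (smoothFunction_eq_zero_of_two_mul h')).symm
  · intro h
    funext α β γ
    rw [key, h, sub_self, mul_zero]
    rfl

/-! ### The concomitant of a bivector and a Nijenhuis operator -/

/-- The Lie derivative `L_X K` of a bundle map, evaluated at `Y`. -/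
def lieDerivEnd (X : Cₛ^∞⟮𝓘(ℝ, E); F, V⟯) (K : BundleEnd E F V) (Y : Cₛ^∞⟮𝓘(ℝ, E); F, V⟯) :
    Cₛ^∞⟮𝓘(ℝ, E); F, V⟯ :=
  A.bracket X (K Y) - K (A.bracket X Y)

theorem lieDerivEnd_mul (X : Cₛ^∞⟮𝓘(ℝ, E); F, V⟯) (K L : BundleEnd E F V)
    (Y : Cₛ^∞⟮𝓘(ℝ, E); F, V⟯) :
    A.lieDerivEnd X (K * L) Y = A.lieDerivEnd X K (L Y) + K (A.lieDerivEnd X L Y) := by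
  simp only [lieDerivEnd, Module.End.mul_apply, map_sub]
  abel

variable {A} in
/-- A Nijenhuis operator satisfies `N ∘ L_X N = L_{NX} N`. -/
theorem IsNijenhuis.lieDerivEnd_apply {N : BundleEnd E F V} (hN : A.IsNijenhuis N)
    (X Y : Cₛ^∞⟮𝓘(ℝ, E); F, V⟯) : A.lieDerivEnd (N X) N Y = N (A.lieDerivEnd X N Y) := by
  rw [lieDerivEnd, lieDerivEnd, sub_eq_zero.mp (hN X Y), deformedBracket, map_sub, map_sub,
    map_add]
  abel

variable {A} in
theorem IsNijenhuis.lieDerivEnd_pow_apply {N : BundleEnd E F V} (hN : A.IsNijenhuis N) (k : ℕ)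
    (X Y : Cₛ^∞⟮𝓘(ℝ, E); F, V⟯) :
    A.lieDerivEnd ((N ^ k) X) N Y = (N ^ k) (A.lieDerivEnd X N Y) := by
  induction k with
  | zero => simp
  | succ k ih =>
    rw [pow_succ', Module.End.mul_apply, hN.lieDerivEnd_apply, ih, Module.End.mul_apply]

/-- The Magri–Morosi concomitant of a bivector and a bundle map, twisted by the 1-form `φ` and
evaluated at the section `Y`: with `D_Y f = ρ(Y) f + φ(Y) f`,
`C(P, K)(α, β)(Y) = α((L_{P♯β} K) Y) - β((L_{P♯α} K) Y) + D_Y β(K P♯α) - D_{KY} P(α, β)`. -/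
def concomitant (φ : OneForm E F V) (P : Bivector E F V) (K : BundleEnd E F V)
    (α β : OneForm E F V) (Y : Cₛ^∞⟮𝓘(ℝ, E); F, V⟯) : C^∞⟮𝓘(ℝ, E), M; ℝ⟯ :=
  α (A.lieDerivEnd (P.sharp β) K Y) - β (A.lieDerivEnd (P.sharp α) K Y)
    + (vfApply (A.anchor Y) (β (K (P.sharp α))) + φ Y * β (K (P.sharp α)))
    - (vfApply (A.anchor (K Y)) (β (P.sharp α)) + φ (K Y) * β (P.sharp α))

/-- The brackets of 1-forms determined by `(A_N, N* φ)`, `P` and by `(A, φ)`, `NP` differ by the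
concomitant. -/
theorem dualBracket_deform_sub (φ : OneForm E F V) (P Q : Bivector E F V) (N : BundleEnd E F V)
    (hN : A.IsNijenhuis N) (hQ : ∀ α, Q.sharp α = N (P.sharp α))
    (α β : OneForm E F V) (Y : Cₛ^∞⟮𝓘(ℝ, E); F, V⟯) :
    (A.deform N hN).dualBracket (N.dualMap φ) P α β Y - A.dualBracket φ Q α β Y
      = A.concomitant φ P N α β Y := by
  simp only [dualBracket_apply, concomitant, hQ, deform, deformedBracket, lieDerivEnd,
    LinearMap.comp_apply, LinearMap.dualMap_apply, map_add, map_sub]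
  ring

/-- When `Q♯ = K P♯ = P♯ K*`, the concomitant measures how far the bracket of 1-forms of `Q` is from
the deformation by `K*` of the bracket of 1-forms of `P`. -/
theorem dualBracket_apply_eq_add_concomitant (φ : OneForm E F V) (P Q : Bivector E F V)
    (K : BundleEnd E F V) (hQ : ∀ α, Q.sharp α = K (P.sharp α))
    (hK : ∀ α, K (P.sharp α) = P.sharp (K.dualMap α)) (α β : OneForm E F V)
    (Y : Cₛ^∞⟮𝓘(ℝ, E); F, V⟯) :
    A.dualBracket φ Q α β Y = A.dualBracket φ P (K.dualMap α) β Y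
      + A.dualBracket φ P α (K.dualMap β) Y - A.dualBracket φ P α β (K Y)
      + A.concomitant φ P K α β Y := by
  simp only [dualBracket_apply, concomitant, hQ, ← hK, lieDerivEnd, LinearMap.dualMap_apply,
    map_sub]
  ring

/-- If `K` commutes with `P♯` and the concomitant vanishes, then `[P, KP]^φ = 0`. -/
theorem schoutenJacobi_eq_zero_of_concomitant {φ : OneForm E F V} {P Q : Bivector E F V}
    {K : BundleEnd E F V} (hP : A.IsJacobiBivector φ P) (hQ : ∀ α, Q.sharp α = K (P.sharp α))
    (hK : ∀ α, K (P.sharp α) = P.sharp (K.dualMap α))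
    (hC : ∀ α β Y, A.concomitant φ P K α β Y = 0) (α β γ : OneForm E F V) :
    A.schoutenJacobi φ P Q α β γ = 0 := by
  rw [isJacobiBivector_iff] at hP
  have h1 := hP (K.dualMap α) β γ
  have h2 := hP α (K.dualMap β) γ
  rw [schoutenJacobi_eq, hQ, hQ, hQ, hK α, hK β, hK (A.dualBracket φ P α β), ← h1, ← h2,
    P.apply_sharp_skew (A.dualBracket φ Q α β),
    dualBracket_apply_eq_add_concomitant A φ P Q K hQ hK, hC, P.apply_sharp_skew _ γ,
    P.apply_sharp_skew _ γ, P.apply_sharp_skew _ γ, LinearMap.dualMap_apply]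
  ring

variable {A} in
/-- If `N` is a Nijenhuis operator commuting with `P♯` and the concomitant vanishes, then `NP` is
a Jacobi bivector along with `P`. -/
theorem IsJacobiBivector.comp_of_concomitant {φ : OneForm E F V} {P Q : Bivector E F V}
    {N : BundleEnd E F V} (hP : A.IsJacobiBivector φ P) (hN : A.IsNijenhuis N)
    (hQ : ∀ α, Q.sharp α = N (P.sharp α))
    (hNP : ∀ α, N (P.sharp α) = P.sharp (N.dualMap α))
    (hC : ∀ α β Y, A.concomitant φ P N α β Y = 0) : A.IsJacobiBivector φ Q := by
  rw [isJacobiBivector_iff]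
  intro α β γ
  have hJ := schoutenJacobi_eq_zero_of_concomitant A hP hQ hNP hC α β (N.dualMap γ)
  have h1 := (A.isJacobiBivector_iff φ P).mp hP α β (N.dualMap (N.dualMap γ))
  have hT := congrArg γ (hN (P.sharp α) (P.sharp β))
  simp only [schoutenJacobi_eq, hQ, LinearMap.dualMap_apply, deformedBracket, map_sub, map_add,
    map_zero] at hJ h1 hT ⊢
  -- Pair `[P, NP]^φ = 0` with `N* γ` and use `N [P♯α, P♯β]_N = [N P♯α, N P♯β]`.
  linear_combination -hJ - hT - h1

/-- Powers of a Nijenhuis operator `N` enter the first argument of the concomitant. -/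
theorem concomitant_comp_pow {φ : OneForm E F V} {P Q : Bivector E F V} {N : BundleEnd E F V}
    (hN : A.IsNijenhuis N) (k : ℕ) (hQ : ∀ α, Q.sharp α = (N ^ k) (P.sharp α))
    (hNP : ∀ α, (N ^ k) (P.sharp α) = P.sharp ((N ^ k).dualMap α)) (α β : OneForm E F V)
    (Y : Cₛ^∞⟮𝓘(ℝ, E); F, V⟯) :
    A.concomitant φ Q N α β Y = A.concomitant φ P N ((N ^ k).dualMap α) β Y := by
  simp only [concomitant, hQ]
  rw [hN.lieDerivEnd_pow_apply k (P.sharp β), hNP α, LinearMap.dualMap_apply]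

/-- The recursion `C(P, N ^ (m + 1))(α, β) = N* C(P, N ^ m)(α, β) + C(P, N)((N*) ^ m α, β)`. -/
theorem concomitant_pow_succ {φ : OneForm E F V} {P : Bivector E F V} {N : BundleEnd E F V}
    (hN : A.IsNijenhuis N) (m : ℕ)
    (hNP : ∀ α, (N ^ m) (P.sharp α) = P.sharp ((N ^ m).dualMap α)) (α β : OneForm E F V)
    (Y : Cₛ^∞⟮𝓘(ℝ, E); F, V⟯) :
    A.concomitant φ P (N ^ (m + 1)) α β Y =
      A.concomitant φ P (N ^ m) α β (N Y)
        + A.concomitant φ P N ((N ^ m).dualMap α) β Y := by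
  have h1 : (N ^ (m + 1)) Y = (N ^ m) (N Y) := by rw [pow_succ, Module.End.mul_apply]
  have h2 : (N ^ (m + 1)) (P.sharp α) = N ((N ^ m) (P.sharp α)) := by
    rw [pow_succ', Module.End.mul_apply]
  have h3 : ∀ X, A.lieDerivEnd X (N ^ (m + 1)) Y =
      A.lieDerivEnd X (N ^ m) (N Y) + (N ^ m) (A.lieDerivEnd X N Y) := by
    intro X
    rw [pow_succ, lieDerivEnd_mul]
  simp only [concomitant, h1, h2, h3, ← hNP, hN.lieDerivEnd_pow_apply, LinearMap.dualMap_apply,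
    map_add]
  ring

theorem concomitant_pow_eq_zero {φ : OneForm E F V} {P : Bivector E F V} {N : BundleEnd E F V}
    (hN : A.IsNijenhuis N)
    (hNP : ∀ k : ℕ, ∀ α, (N ^ k) (P.sharp α) = P.sharp ((N ^ k).dualMap α))
    (hC : ∀ α β Y, A.concomitant φ P N α β Y = 0) (m : ℕ) (α β : OneForm E F V)
    (Y : Cₛ^∞⟮𝓘(ℝ, E); F, V⟯) : A.concomitant φ P (N ^ m) α β Y = 0 := by
  induction m generalizing Y with
  | zero => simp [concomitant, lieDerivEnd]
  | succ m ih => rw [concomitant_pow_succ A hN m (hNP m), ih, hC, add_zero]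

/-! ### The hierarchy of Jacobi bivectors -/

namespace IsJacobiNijenhuis

variable {A} {φ₀ : OneForm E F V} {P : Bivector E F V} {N : BundleEnd E F V}

theorem concomitant_eq_zero (h : A.IsJacobiNijenhuis φ₀ P N) (α β : OneForm E F V)
    (Y : Cₛ^∞⟮𝓘(ℝ, E); F, V⟯) : A.concomitant φ₀ P N α β Y = 0 := by
  rw [← A.dualBracket_deform_sub φ₀ P (P.iterate N h.comm 1) N h.nijenhuis
    (fun α => by simp [Bivector.iterate]), h.bracket_eq, sub_self]

theorem iterate_sharp_comm (h : A.IsJacobiNijenhuis φ₀ P N) (i k : ℕ) (α : OneForm E F V) :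
    (N ^ k) ((P.iterate N h.comm i).sharp α) =
      (P.iterate N h.comm i).sharp ((N ^ k).dualMap α) := by
  change (N ^ k) ((N ^ i) (P.sharp α)) = (N ^ i) (P.sharp ((N ^ k).dualMap α))
  rw [← Bivector.pow_sharp_comm h.comm, ← Module.End.mul_apply, ← Module.End.mul_apply, ← pow_add,
    ← pow_add, add_comm]

theorem iterate_concomitant_eq_zero (h : A.IsJacobiNijenhuis φ₀ P N) (k : ℕ) (α β : OneForm E F V)
    (Y : Cₛ^∞⟮𝓘(ℝ, E); F, V⟯) :
    A.concomitant φ₀ (P.iterate N h.comm k) N α β Y = 0 := by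
  rw [A.concomitant_comp_pow h.nijenhuis k (fun _ => rfl) (Bivector.pow_sharp_comm h.comm k),
    h.concomitant_eq_zero]

theorem iterate_isJacobiBivector (h : A.IsJacobiNijenhuis φ₀ P N) (k : ℕ) :
    A.IsJacobiBivector φ₀ (P.iterate N h.comm k) := by
  induction k with
  | zero => exact h.jacobi
  | succ k ih =>
    refine ih.comp_of_concomitant h.nijenhuis (fun α => ?_) (fun α => ?_)
      (h.iterate_concomitant_eq_zero k)
    · change (N ^ (k + 1)) (P.sharp α) = N ((N ^ k) (P.sharp α))
      rw [pow_succ', Module.End.mul_apply]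
    · simpa using h.iterate_sharp_comm k 1 α

theorem schoutenJacobi_iterate_add (h : A.IsJacobiNijenhuis φ₀ P N) (i m : ℕ)
    (α β γ : OneForm E F V) :
    A.schoutenJacobi φ₀ (P.iterate N h.comm i) (P.iterate N h.comm (i + m)) α β γ = 0 := by
  refine A.schoutenJacobi_eq_zero_of_concomitant (h.iterate_isJacobiBivector i) (fun α => ?_)
    (h.iterate_sharp_comm i m)
    (A.concomitant_pow_eq_zero h.nijenhuis (h.iterate_sharp_comm i)
      (h.iterate_concomitant_eq_zero i) m) α β γ
  change (N ^ (i + m)) (P.sharp α) = (N ^ m) ((N ^ i) (P.sharp α))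
  rw [add_comm, pow_add, Module.End.mul_apply]

theorem schoutenJacobi_iterate (h : A.IsJacobiNijenhuis φ₀ P N) (i j : ℕ) (α β γ : OneForm E F V) :
    A.schoutenJacobi φ₀ (P.iterate N h.comm i) (P.iterate N h.comm j) α β γ = 0 := by
  rcases le_total i j with hij | hij
  · obtain ⟨m, rfl⟩ := Nat.exists_eq_add_of_le hij
    exact h.schoutenJacobi_iterate_add i m α β γ
  · obtain ⟨m, rfl⟩ := Nat.exists_eq_add_of_le hij
    rw [schoutenJacobi_comm]
    exact h.schoutenJacobi_iterate_add j m α β γ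

theorem iterate_add_isJacobiBivector (h : A.IsJacobiNijenhuis φ₀ P N) (i j : ℕ) :
    A.IsJacobiBivector φ₀ (P.iterate N h.comm i + P.iterate N h.comm j) := by
  funext α β γ
  simp [schoutenJacobi_add_add, h.schoutenJacobi_iterate]

end IsJacobiNijenhuis

/-! ### Induced structures on the base manifold -/

theorem dForm_dualMap_anchor (α : OneForm E E (TangentSpace 𝓘(ℝ, E) : M → Type _))
    (X Y : Cₛ^∞⟮𝓘(ℝ, E); F, V⟯) :
    A.dForm (A.anchor.dualMap α) X Y =
      (tangentAlgebroid E M).dForm α (A.anchor X) (A.anchor Y) := by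
  simp only [dForm_apply, LinearMap.dualMap_apply, A.anchor_bracket]
  rfl

theorem lieDeriv_dualMap_anchor (X : Cₛ^∞⟮𝓘(ℝ, E); F, V⟯)
    (α : OneForm E E (TangentSpace 𝓘(ℝ, E) : M → Type _)) :
    A.lieDeriv X (A.anchor.dualMap α)
      = A.anchor.dualMap ((tangentAlgebroid E M).lieDeriv (A.anchor X) α) := by
  ext1 Y
  simp only [lieDeriv_apply, LinearMap.dualMap_apply, A.anchor_bracket]
  rfl

/-- The Schouten bracket of bivectors is natural under the anchor. -/
theorem schouten_baseBivector (P Q : Bivector E F V)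
    (α β γ : OneForm E E (TangentSpace 𝓘(ℝ, E) : M → Type _)) :
    (tangentAlgebroid E M).schouten (A.baseBivector P) (A.baseBivector Q) α β γ =
      A.schouten P Q (A.anchor.dualMap α) (A.anchor.dualMap β) (A.anchor.dualMap γ) := by
  simp only [schouten, schoutenTerm, dForm_dualMap_anchor]
  rfl

theorem schoutenSection_baseBivector (X : Cₛ^∞⟮𝓘(ℝ, E); F, V⟯) (Q : Bivector E F V)
    (α β : OneForm E E (TangentSpace 𝓘(ℝ, E) : M → Type _)) :
    (tangentAlgebroid E M).schoutenSection (A.anchor X) (A.baseBivector Q) α β =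
      A.schoutenSection X Q (A.anchor.dualMap α) (A.anchor.dualMap β) := by
  simp only [schoutenSection, lieDeriv_dualMap_anchor]
  rfl

/-- Contracting `[P, P]^φ` with the cocycle `φ` gives `2 [P♯φ, P]`. -/
theorem schoutenJacobi_cocycle {φ : OneForm E F V} (hφ : A.IsCocycle φ) (P : Bivector E F V)
    (α β : OneForm E F V) :
    A.schoutenJacobi φ P P φ α β = 2 * A.schoutenSection (P.sharp φ) P α β := by
  have hd : ∀ X Y, A.dForm φ X Y = 0 := fun X Y => by rw [hφ]; rfl
  simp only [schoutenJacobi, schouten, schoutenTerm, hd, wedgeBivector, schoutenSection,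
    Bivector.eval, P.alternating]
  rw [P.apply_sharp_skew (A.lieDeriv (P.sharp φ) α) β]
  simp only [lieDeriv_apply, dForm_apply]
  rw [P.apply_sharp_skew φ α, P.apply_sharp_skew φ β, P.apply_sharp_skew β α,
    A.bracket_skew (P.sharp β) (P.sharp φ)]
  simp only [vfApply_neg_right, map_neg]
  ring

variable {A} in
/-- A Jacobi bivector on `(A, φ)` induces a Jacobi structure on the base manifold. -/
theorem IsJacobiBivector.isJacobiStructure_base {φ : OneForm E F V} (hφ : A.IsCocycle φ)
    {P : Bivector E F V} (hP : A.IsJacobiBivector φ P) :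
    IsJacobiStructure (A.baseBivector P) (A.baseVectorField φ P) := by
  have h0 : ∀ α β γ, A.schoutenJacobi φ P P α β γ = 0 := fun α β γ =>
    congrFun (congrFun (congrFun hP α) β) γ
  constructor
  · funext α β γ
    have h1 := h0 (A.anchor.dualMap α) (A.anchor.dualMap β) (A.anchor.dualMap γ)
    have h2 : wedgeBivector (A.baseVectorField φ P) (A.baseBivector P) α β γ =
      wedgeBivector (P.sharp φ) P (A.anchor.dualMap α) (A.anchor.dualMap β)
        (A.anchor.dualMap γ) := rfl
    rw [schoutenJacobi] at h1
    simp only [Pi.smul_apply]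
    rw [schouten_baseBivector, h2, neg_smul, two_smul]
    linear_combination h1
  · funext α β
    rw [baseVectorField, schoutenSection_baseBivector]
    apply smoothFunction_eq_zero_of_two_mul
    rw [← A.schoutenJacobi_cocycle hφ, h0]

theorem baseBivector_add (P Q : Bivector E F V) :
    A.baseBivector (P + Q) = A.baseBivector P + A.baseBivector Q := by
  ext1
  ext1 α
  exact A.anchor.map_add _ _

theorem baseVectorField_add (φ : OneForm E F V) (P Q : Bivector E F V) :
    A.baseVectorField φ (P + Q) = A.baseVectorField φ P + A.baseVectorField φ Q :=
  A.anchor.map_add _ _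

end LieAlgebroid

end JacobiNijenhuis

end

theorem mainTheorem5
    {E : Type*} [NormedAddCommGroup E] [NormedSpace ℝ E] [FiniteDimensional ℝ E]
    {M : Type*} [TopologicalSpace M] [T2Space M] [SigmaCompactSpace M]
    [ChartedSpace E M] [IsManifold 𝓘(ℝ, E) ∞ M]
    {F : Type*} [NormedAddCommGroup F] [NormedSpace ℝ F] [FiniteDimensional ℝ F]
    {V : M → Type*} [TopologicalSpace (TotalSpace F V)]
    [∀ x, TopologicalSpace (V x)] [FiberBundle F V]
    [∀ x, AddCommGroup (V x)] [∀ x, Module ℝ (V x)] [VectorBundle ℝ F V]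
    [ContMDiffVectorBundle ∞ F V 𝓘(ℝ, E)]
    (A : LieAlgebroid E F V) (φ₀ : OneForm E F V) (P : Bivector E F V) (N : BundleEnd E F V)
    (h : A.IsJacobiNijenhuis φ₀ P N) :
    (∀ k : ℕ, IsJacobiStructure
      (A.baseBivector (P.iterate N h.comm k)) (A.baseVectorField φ₀ (P.iterate N h.comm k))) ∧
    ∀ i j : ℕ, AreCompatibleJacobi
      (A.baseBivector (P.iterate N h.comm i)) (A.baseVectorField φ₀ (P.iterate N h.comm i))
      (A.baseBivector (P.iterate N h.comm j)) (A.baseVectorField φ₀ (P.iterate N h.comm j)) := by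
  have hJ : ∀ k, IsJacobiStructure (A.baseBivector (P.iterate N h.comm k))
      (A.baseVectorField φ₀ (P.iterate N h.comm k)) := fun k =>
    (h.iterate_isJacobiBivector k).isJacobiStructure_base h.cocycle
  refine ⟨hJ, fun i j => ⟨hJ i, hJ j, ?_⟩⟩
  rw [← A.baseBivector_add, ← A.baseVectorField_add]
  exact (h.iterate_add_isJacobiBivector i j).isJacobiStructure_base h.cocycle
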